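/- Let $T$ be a complete first-order theory in a language $L$, let $\kappa>\aleph_0+|L|$ be a cardinal, and let $\mathfrak C\models T$ be a monster model, i.e. $\mathfrak C$ is $\kappa$-saturated and strongly $\kappa$-homogeneous (every partial elementary map between subsets of $\mathfrak C$ of cardinality $<\kappa$ extends to an automorphism of $\mathfrak C$). "Small", "short" and "bounded" mean "of cardinality $<\kappa$". Let $\mathrm{Autf}_L(\mathfrak C)\trianglelefteq\mathrm{Aut}(\mathfrak C)$ be the subgroup generated by all automorphisms of $\mathfrak C$ which fix pointwise some small elementary submodel of $\mathfrak C$, and let $\mathrm{Gal}_L(T)=\mathrm{Aut}(\mathfrak C)/\mathrm{Autf}_L(\mathfrak C)$. For a small $N\prec\mathfrak C$ enumerated as $\bar n$, equip $\mathrm{Gal}_L(T)$ with the quotient topology induced by the surjection $\mathrm{tp}(\sigma(\bar n)/N)\mapsto\sigma\,\mathrm{Autf}_L(\mathfrak C)$ from the space of complete types over $N$ extending $\mathrm{tp}(\bar n/\emptyset)$ (this topology does not depend on $N$). Let $\mathrm{Autf}_{KP}(\mathfrak C)$ be the preimage, under the quotient map $\mathrm{Aut}(\mathfrak C)\to\mathrm{Gal}_L(T)$,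 of the closure of the identity of $\mathrm{Gal}_L(T)$. A subset of $\mathrm{Aut}(\mathfrak C)$ is relatively type-definable if it is of the form $\{\sigma\in\mathrm{Aut}(\mathfrak C):\mathfrak C\models\pi(\sigma(\bar a),\bar b)\}$ for some partial type $\pi(\bar x,\bar y)$ without parameters in short tuples of variables $\bar x,\bar y$ and some corresponding tuples $\bar a,\bar b$ from $\mathfrak C$. If $G$ is a relatively type-definable subgroup of $\mathrm{Aut}(\mathfrak C)$ whose index is bounded (i.e. $[\mathrm{Aut}(\mathfrak C):G]<\kappa$), then $\mathrm{Autf}_{KP}(\mathfrak C)\le G$. (This holds with $\mathrm{Autf}_{KP}(\mathfrak C)$ computed from any small $N\prec\mathfrak C$.) -/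

import Mathlib

open FirstOrder FirstOrder.Language Cardinal

universe u v w

namespace MonsterModel

/-- The automorphism group of a first-order structure, under composition. -/
instance autGroup {L : FirstOrder.Language.{u, v}} {C : Type w} [L.Structure C] : Group (C ≃[L] C) where
  mul σ τ := σ.comp τ
  one := Language.Equiv.refl L C
  inv σ := σ.symm
  mul_assoc σ τ ρ := (Language.Equiv.comp_assoc ρ τ σ).symm
  one_mul σ := Language.Equiv.refl_comp σ
  mul_one σ := Language.Equiv.comp_refl σ
  inv_mul_cancel σ := Language.Equiv.symm_comp_self σ

variable (L : FirstOrder.Language.{u, v}) (C : Type w) [L.Structure C]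

/-- `C` is `κ`-saturated: over every parameter set `A` of cardinality `< κ`, every set of
`L(A)`-formulas in one variable which is finitely satisfiable in `C` is satisfiable in `C`. -/
def IsSaturated (κ : Cardinal.{w}) : Prop :=
  ∀ A : Set C, #A < κ → ∀ p : Set (L[[A]].Formula (Fin 1)),
    (∀ p₀ ⊆ p, p₀.Finite → ∃ x : Fin 1 → C, ∀ φ ∈ p₀, φ.Realize x) →
      ∃ x : Fin 1 → C, ∀ φ ∈ p, φ.Realize x

/-- `C` is strongly `κ`-homogeneous: every partial elementary map between subsets of `C` of
cardinality `< κ` extends to an automorphism of `C`. -/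
def IsStronglyHomogeneous (κ : Cardinal.{w}) : Prop :=
  ∀ A : Set C, #A < κ → ∀ f : A → C,
    (∀ φ : L.Formula A, φ.Realize (fun a : A => (a : C)) ↔ φ.Realize f) →
      ∃ σ : C ≃[L] C, ∀ a : A, σ a = f a

variable {L} in
/-- `C` is a monster model (with degree of saturation `κ`) of the complete theory `T`. The number
of formulas `|T|` is `ℵ₀ + |L|`. "Small", "short" and "bounded" mean "of cardinality `< κ`". -/
structure IsMonster (T : L.Theory) (κ : Cardinal.{w}) : Prop where
  complete : T.IsComplete
  model : C ⊨ T
  aleph0_lt : ℵ₀ < κ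
  card_lt : Cardinal.lift.{w} L.card < Cardinal.lift.{max u v} κ
  saturated : IsSaturated L C κ
  homogeneous : IsStronglyHomogeneous L C κ

/-- The group of Lascar strong automorphisms: the subgroup generated by all automorphisms fixing
pointwise some small elementary substructure. -/
def autfL (κ : Cardinal.{w}) : Subgroup (C ≃[L] C) :=
  Subgroup.closure
    {σ | ∃ N : L.ElementarySubstructure C, #N < κ ∧ ∀ x ∈ N, σ x = x}

variable {L C}

/-- The image of a small elementary substructure under an automorphism is again a small
elementary substructure. -/
theorem exists_map_elementarySubstructure (σ : C ≃[L] C) (N : L.ElementarySubstructure C) :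
    ∃ N' : L.ElementarySubstructure C, (N' : Set C) = σ '' (N : Set C) ∧ #N' = #N := by
  let e := σ.toEmbedding.substructureEquivMap (N : L.Substructure C)
  have he : ∀ y : (N : L.Substructure C), ((e y : _) : C) = σ y := fun y =>
    σ.toEmbedding.substructureEquivMap_apply _ y
  refine ⟨⟨(N : L.Substructure C).map σ.toEmbedding.toHom, ?_⟩, rfl, ?_⟩
  · intro n φ x
    have hx : (fun i => (x i : C)) =
        σ ∘ (fun i => ((e.symm (x i) : (N : L.Substructure C)) : C)) := by
      funext i
      have h := he (e.symm (x i))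
      rw [e.apply_symm_apply] at h
      exact h
    change φ.Realize (fun i => (x i : C)) ↔ φ.Realize x
    rw [hx, StrongHomClass.realize_formula σ φ]
    exact (N.isElementary φ (e.symm ∘ x)).trans (StrongHomClass.realize_formula e.symm φ)
  · exact (Cardinal.mk_congr e.toEquiv).symm

/-- The group of Lascar strong automorphisms is normal, so that the quotient by it is a group. -/
instance autfL_normal (κ : Cardinal.{w}) : (autfL L C κ).Normal := by
  refine Subgroup.Normal.mk fun σ hσ τ => ?_
  have key : autfL L C κ ≤ (autfL L C κ).comap (MulAut.conj τ).toMonoidHom := by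
    refine (Subgroup.closure_le _).2 ?_
    rintro ρ ⟨N, hN, hρ⟩
    obtain ⟨N', hN', hc⟩ := exists_map_elementarySubstructure τ N
    refine Subgroup.subset_closure ⟨N', hc ▸ hN, fun x hx => ?_⟩
    have hx' : x ∈ τ '' (N : Set C) := hN' ▸ hx
    obtain ⟨y, hy, rfl⟩ := hx'
    change τ (ρ (τ.symm (τ y))) = τ y
    rw [τ.symm_apply_apply, hρ y hy]
  exact key hσ

variable (L C) in
/-- The Lascar Galois group. -/
abbrev GalL (κ : Cardinal.{w}) : Type w := (C ≃[L] C) ⧸ autfL L C κ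

/-- For a small `N ≺ C`, enumerated by itself as the tuple `n̄ = (x)_{x ∈ N}`, and an automorphism
`σ`, this is the complete type `tp(σ(n̄)/N)`. -/
noncomputable def typeMap [Nonempty C] (N : L.ElementarySubstructure C) (σ : C ≃[L] C) :
    (L[[(N : Set C)]].completeTheory C).CompleteType N :=
  Theory.typeOf _ (fun x : N => σ x)

/-- The topology of the Lascar Galois group computed from `N`: the quotient topology induced by the
surjection `S_n̄(N) → GalL`, `tp(σ(n̄)/N) ↦ σ · autfL`. In a monster model `S_n̄(N)`, the space of
complete types over `N` extending `tp(n̄/∅)`, is exactly the image of `typeMap N`; so `U` is open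
iff there is an open set `V` of types such that, for all `σ`, the class of `σ` is in `U` iff
`tp(σ(n̄)/N) ∈ V`. This is the topology on the quotient coinduced by the topology that `typeMap N`
induces on the automorphism group. -/
@[reducible]
noncomputable def galLTopology [Nonempty C] (κ : Cardinal.{w}) (N : L.ElementarySubstructure C) :
    TopologicalSpace (GalL L C κ) :=
  TopologicalSpace.coinduced (fun σ : C ≃[L] C => (σ : GalL L C κ))
    (TopologicalSpace.induced (typeMap N) inferInstance)

/-- The Kim-Pillay strong automorphisms: the preimage in the automorphism group of the closure of
the identity of the Lascar Galois group, with its topology computed from `N`. (For small `N` the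
topology does not depend on `N`.) -/
def autfKP [Nonempty C] (κ : Cardinal.{w}) (N : L.ElementarySubstructure C) : Set (C ≃[L] C) :=
  {σ | (σ : GalL L C κ) ∈ @closure (GalL L C κ) (galLTopology κ N) {1}}

/-- A set of automorphisms is relatively type-definable if it is
`{σ | C ⊨ π(σ(ā), b̄)}` for a set `π(x̄, ȳ)` of formulas without parameters in short tuples of
variables `x̄`, `ȳ` and corresponding tuples `ā`, `b̄` of elements of `C`. -/
def IsRelativelyTypeDefinable (κ : Cardinal.{w}) (X : Set (C ≃[L] C)) : Prop :=
  ∃ (ι ι' : Type w) (π : Set (L.Formula (ι ⊕ ι'))) (a : ι → C) (b : ι' → C),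
    #ι < κ ∧ #ι' < κ ∧
      X = {σ | ∀ φ ∈ π, φ.Realize (Sum.elim (fun i => σ (a i)) b)}

end MonsterModel

namespace MonsterModel

variable {L : FirstOrder.Language.{u, v}} {C : Type w} [L.Structure C]

/-! It suffices that the image of `G` in `GalL` is closed, contains the identity and has preimage
`G`. Preimage: `G` contains the stabilizer of a short tuple `a`, because membership of `σ` depends
only on `σ(a)`. As the index is bounded, the normal core contains the stabilizer of a short tuple
`d` listing conjugates of `a`. If `σ` fixes a submodel `M`, take `e` realizing a coheir of `tp(d/M)`
over `d` and `σ(d)`. Then `d` and `σ(d)` have the same type over `e`, so `σ` is a product of an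
automorphism fixing `e` and one fixing `d`, both in the core. Hence `autfL ≤ G`. Closedness: along
an ultrafilter on `G` whose types over `N` converge to that of `σ`, saturation yields a limit
automorphism. It satisfies `π`, so it lies in `G`, and it differs from `σ` by automorphisms fixing
`N`. -/

/-- A formula depends only on finitely many of its variables. -/
theorem exists_formula_finset {α : Type*} (φ : L.Formula α) :
    ∃ (s : Finset α) (ψ : L.Formula s),
      ∀ x : α → C, φ.Realize x ↔ ψ.Realize (fun i => x i) := by
  classical
  exact ⟨φ.freeVarFinset, φ.restrictFreeVar id, fun x =>
    (BoundedFormula.realize_restrictFreeVar (φ := φ) (f := id) x (fun _ => rfl)).symm⟩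

theorem realize_constantsVarsEquiv_symm {A : Set C} {β : Type*} (φ : L.Formula (A ⊕ β))
    (y : β → C) :
    Formula.Realize (L := L[[A]]) (BoundedFormula.constantsVarsEquiv.symm φ) y ↔
      φ.Realize (Sum.elim (fun a : A => (a : C)) y) := by
  have h := BoundedFormula.realize_constantsVarsEquiv (M := C) (v := y) (xs := default)
    (φ := (BoundedFormula.constantsVarsEquiv (L := L)).symm φ)
  rw [Equiv.apply_symm_apply] at h
  exact h.symm

/-! ### Realizing limit types of short tuples -/

/-- The relation `R` between variables and elements of `C`, seen as a tuple indexed by `R`,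
satisfies every formula that holds of `U`-almost all tuples. -/
def RealizesLimit {α : Type*} (U : Ultrafilter (α → C)) (R : Set (α × C)) : Prop :=
  ∀ φ : L.Formula R, (∀ᶠ x in (U : Filter (α → C)), φ.Realize (fun r : R => x r.1.1)) →
    φ.Realize (fun r : R => r.1.2)

theorem RealizesLimit.mono {α : Type*} {U : Ultrafilter (α → C)} {R S : Set (α × C)}
    (hS : RealizesLimit (L := L) U S) (h : R ⊆ S) : RealizesLimit (L := L) U R := by
  intro φ hφ
  have := hS (φ.relabel (Set.inclusion h))
  simp only [Formula.realize_relabel] at this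
  exact this hφ

/-- Each formula mentions finitely many pairs of `R`. This gives maximal partial realizations by the
Teichmüller–Tukey lemma. -/
theorem isOfFiniteCharacter_realizesLimit {α : Type*} (U : Ultrafilter (α → C)) :
    Order.IsOfFiniteCharacter {R : Set (α × C) | RealizesLimit (L := L) U R} := by
  refine fun R => ⟨fun h S hS _ => h.mono hS, fun h φ hφ => ?_⟩
  obtain ⟨s, ψ, hψ⟩ := exists_formula_finset (C := C) φ
  let S : Set (α × C) := Subtype.val '' (s : Set R)
  have hS : S ⊆ R := by rintro _ ⟨r, -, rfl⟩; exact r.2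
  have key := h S hS (s.finite_toSet.image _)
    (ψ.relabel (fun r : s => (⟨r.1.1, r.1, r.2, rfl⟩ : S)))
  simp only [Formula.realize_relabel] at key
  simp only [hψ] at hφ ⊢
  exact key hφ

/-- Equality of the two copies of variable `i` holds along all of `U`. So `R` is the graph of a
partial function and involves at most `#α` parameters. -/
theorem RealizesLimit.functional {α : Type*} {U : Ultrafilter (α → C)} {R : Set (α × C)}
    (hR : RealizesLimit (L := L) U R) {i : α} {c d : C} (hc : (i, c) ∈ R) (hd : (i, d) ∈ R) :
    c = d := by
  have key := hR (Term.equal (Term.var ⟨_, hc⟩) (Term.var ⟨_, hd⟩))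
  simpa [Formula.realize_equal] using key

theorem RealizesLimit.exists_insert {α : Type w} {κ : Cardinal.{w}} (hC : IsSaturated L C κ)
    (hα : #α < κ) {U : Ultrafilter (α → C)} {R : Set (α × C)}
    (hR : RealizesLimit (L := L) U R) (i : α) :
    ∃ c, RealizesLimit (L := L) U (insert (i, c) R) := by
  classical
  let A : Set C := Prod.snd '' R
  have hA : #A < κ := by
    refine (mk_image_le.trans ?_).trans_lt hα
    refine mk_le_of_injective (f := fun r : R => r.1.1) ?_
    rintro ⟨⟨j, c⟩, hc⟩ ⟨⟨k, d⟩, hd⟩ (rfl : j = k)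
    simp [hR.functional hc hd]
  let tr : L.Formula (R ⊕ Unit) → L[[A]].Formula (Fin 1) := fun φ =>
    BoundedFormula.constantsVarsEquiv.symm
      (φ.relabel (Sum.map (fun r : R => (⟨r.1.2, r.1, r.2, rfl⟩ : A)) (fun _ => (0 : Fin 1))))
  have htr : ∀ φ (y : Fin 1 → C), (tr φ).Realize y ↔
      φ.Realize (Sum.elim (fun r : R => r.1.2) (fun _ => y 0)) := by
    intro φ y
    refine (realize_constantsVarsEquiv_symm _ _).trans ?_
    rw [Formula.realize_relabel]
    exact iff_of_eq (congrArg _ (by ext (_ | _) <;> rfl))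
  let P : Set (L.Formula (R ⊕ Unit)) :=
    {φ | ∀ᶠ x in (U : Filter (α → C)), φ.Realize (Sum.elim (fun r : R => x r.1.1) (fun _ => x i))}
  obtain ⟨y, hy⟩ := hC A hA (tr '' P) (by
    intro p₀ hp₀ hfin
    have := hfin.to_subtype
    choose f hf hf' using fun ψ : p₀ => hp₀ ψ.2
    -- Finite satisfiability: the existential statement holds for almost all `x`, witnessed by `x
    -- i`, so it passes to `R`.
    have key := hR ((Formula.iInf f).iExs Unit) (by
      have : ∀ᶠ x in (U : Filter (α → C)), ∀ ψ, (f ψ).Realize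
          (Sum.elim (fun r : R => x r.1.1) (fun _ => x i)) := Filter.eventually_all.2 hf
      filter_upwards [this] with x hx
      rw [Formula.realize_iExs]
      exact ⟨_, Formula.realize_iInf.2 hx⟩)
    rw [Formula.realize_iExs] at key
    obtain ⟨u, hu⟩ := key
    refine ⟨fun _ => u (), fun ψ hψ => ?_⟩
    rw [← show tr (f ⟨ψ, hψ⟩) = ψ from hf' _, htr]
    exact Formula.realize_iInf.1 hu ⟨ψ, hψ⟩)
  refine ⟨y 0, fun φ hφ => ?_⟩
  let g : ↥(insert (i, y 0) R) → R ⊕ Unit := fun r =>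
    if h : r.1 ∈ R then Sum.inl ⟨r.1, h⟩ else Sum.inr ()
  have hg : ∀ r : ↥(insert (i, y 0) R), r.1 ∉ R → r.1 = (i, y 0) := fun r hr =>
    (Set.mem_insert_iff.1 r.2).resolve_right hr
  have key := hy (tr (φ.relabel g)) ⟨_, ?_, rfl⟩
  · rw [htr, Formula.realize_relabel] at key
    convert key using 1
    ext r
    by_cases h : r.1 ∈ R
    · simp [g, h]
    · rw [Function.comp_apply, show g r = Sum.inr () from dif_neg h, hg r h, Sum.elim_inr]
  · change ∀ᶠ x in (U : Filter (α → C)), _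
    filter_upwards [hφ] with x hx
    rw [Formula.realize_relabel]
    convert hx using 1
    ext r
    by_cases h : r.1 ∈ R
    · simp [g, h]
    · rw [Function.comp_apply, show g r = Sum.inr () from dif_neg h, hg r h, Sum.elim_inr]

/-- In a `κ`-saturated structure, the limit type along an ultrafilter of tuples of length `< κ`
is realized. -/
theorem IsSaturated.exists_realize_ultrafilter {α : Type w} {κ : Cardinal.{w}}
    (hC : IsSaturated L C κ) (hα : #α < κ) (U : Ultrafilter (α → C)) :
    ∃ f : α → C, ∀ φ : L.Formula α, (∀ᶠ x in (U : Filter (α → C)), φ.Realize x) → φ.Realize f := by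
  have h0 : RealizesLimit (L := L) U (∅ : Set (α × C)) := by
    intro φ hφ
    obtain ⟨x, hx⟩ := hφ.exists
    convert hx using 1
    ext r
    exact r.2.elim
  obtain ⟨R, -, hR⟩ := (isOfFiniteCharacter_realizesLimit (L := L) U).exists_maximal h0
  have hex : ∀ i, ∃ c, (i, c) ∈ R := by
    intro i
    obtain ⟨c, hc⟩ := RealizesLimit.exists_insert hC hα hR.prop i
    exact ⟨c, hR.le_of_ge hc (Set.subset_insert _ _) (Set.mem_insert _ _)⟩
  choose f hf using hex
  refine ⟨f, fun φ hφ => ?_⟩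
  have key := hR.prop (φ.relabel (fun i => ⟨_, hf i⟩))
  simp only [Formula.realize_relabel] at key
  exact key hφ

/-- Two tuples of length `< κ` with the same type are conjugate under an automorphism. -/
theorem IsStronglyHomogeneous.exists_equiv {α : Type w} {κ : Cardinal.{w}}
    (hC : IsStronglyHomogeneous L C κ) (hα : #α < κ) {f g : α → C}
    (h : ∀ φ : L.Formula α, φ.Realize f → φ.Realize g) :
    ∃ σ : C ≃[L] C, ∀ i, σ (f i) = g i := by
  have hiff : ∀ φ : L.Formula α, φ.Realize f ↔ φ.Realize g := fun φ =>
    ⟨h φ, fun hg => by_contra fun hf => h φ.not hf hg⟩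
  have hfg : ∀ i j, f i = f j → g i = g j := by
    intro i j hij
    have := h (Term.equal (Term.var i) (Term.var j))
    simp only [Formula.realize_equal, Term.realize_var] at this
    exact this hij
  choose s hs using fun a : Set.range f => a.2
  obtain ⟨σ, hσ⟩ := hC (Set.range f) (mk_range_le.trans_lt hα) (fun a => g (s a)) (by
    intro φ
    have := hiff (φ.relabel s)
    simp only [Formula.realize_relabel] at this
    rwa [show f ∘ s = fun a : Set.range f => (a : C) from funext hs] at this)
  exact ⟨σ, fun i => (hσ ⟨f i, i, rfl⟩).trans (hfg _ _ (hs _))⟩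

/-- In a monster model, the limit type along an ultrafilter of short tuples is realized over a
short tuple of parameters. -/
theorem exists_realize_ultrafilter_over {α β : Type w} {κ : Cardinal.{w}}
    (hsat : IsSaturated L C κ) (hhom : IsStronglyHomogeneous L C κ) (hκ : ℵ₀ ≤ κ)
    (hα : #α < κ) (hβ : #β < κ) (U : Ultrafilter (α → C)) (b : β → C) :
    ∃ f : α → C, ∀ φ : L.Formula (α ⊕ β),
      (∀ᶠ x in (U : Filter (α → C)), φ.Realize (Sum.elim x b)) → φ.Realize (Sum.elim f b) := by
  have hαβ : #(α ⊕ β) < κ := by simpa using add_lt_of_lt hκ hα hβ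
  obtain ⟨g, hg⟩ := hsat.exists_realize_ultrafilter hαβ (U.map (fun x => Sum.elim x b))
  simp only [Ultrafilter.coe_map, Filter.eventually_map] at hg
  -- The `β`-part is constantly `b` along the ultrafilter, so its limit has the type of `b` and can
  -- be moved back to `b`.
  obtain ⟨σ, hσ⟩ := hhom.exists_equiv hβ (f := b) (g := g ∘ Sum.inr) (by
    intro φ hφ
    have := hg (φ.relabel Sum.inr)
    simp only [Formula.realize_relabel] at this
    exact this (Filter.Eventually.of_forall fun x => by rwa [Sum.elim_comp_inr]))
  refine ⟨fun i => σ.symm (g (Sum.inl i)), fun φ hφ => ?_⟩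
  have h : φ.Realize (σ.symm ∘ g) := (StrongHomClass.realize_formula σ.symm φ).2 (hg φ hφ)
  convert h using 1
  ext (i | j)
  · rfl
  · exact (σ.symm_apply_apply (b j)).symm.trans (congrArg σ.symm (hσ j))

/-! ### Stabilizers of submodels -/

/-- Every tuple has a coheir over an elementary substructure: there is an ultrafilter on the tuples
from the substructure along which the type of the tuple holds. -/
theorem exists_ultrafilter_elementarySubstructure [Nonempty C] {α : Type*}
    (M : L.ElementarySubstructure C) (d : α → C) :
    ∃ U : Ultrafilter (α → C), (∀ᶠ x in (U : Filter (α → C)), ∀ i, x i ∈ M) ∧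
      ∀ φ : L.Formula α, φ.Realize d → ∀ᶠ x in (U : Filter (α → C)), φ.Realize x := by
  classical
  have hne : Nonempty M := M.elementarilyEquivalent.nonempty_iff.2 inferInstance
  let D := {φ : L.Formula α // φ.Realize d}
  let S : D → Set (α → C) := fun φ => {x | (∀ i, x i ∈ M) ∧ φ.1.Realize x}
  have : Nonempty D := ⟨⟨⊤, Formula.realize_top.2 trivial⟩⟩
  have hdir : Directed (· ≥ ·) (fun φ => Filter.principal (S φ)) := by
    intro φ ψ
    refine ⟨⟨φ.1 ⊓ ψ.1, Formula.realize_inf.2 ⟨φ.2, ψ.2⟩⟩, ?_, ?_⟩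
    · exact Filter.principal_mono.2 fun x hx => ⟨hx.1, (Formula.realize_inf.1 hx.2).1⟩
    · exact Filter.principal_mono.2 fun x hx => ⟨hx.1, (Formula.realize_inf.1 hx.2).2⟩
  have hS : ∀ φ, (Filter.principal (S φ)).NeBot := by
    rintro ⟨φ, hφ⟩
    rw [Filter.principal_neBot_iff]
    obtain ⟨s, ψ, hψ⟩ := exists_formula_finset (C := C) φ
    have hex : ((ψ.relabel Sum.inr).iExs s : L.Formula Empty).Realize (M := C)
        (M.subtype ∘ Empty.elim) := by
      rw [Formula.realize_iExs]
      exact ⟨fun i => d i, by simpa using (hψ d).1 hφ⟩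
    rw [ElementaryEmbedding.map_formula, Formula.realize_iExs] at hex
    obtain ⟨m, hm⟩ := hex
    rw [Formula.realize_relabel, Sum.elim_comp_inr, ← M.subtype.map_formula] at hm
    obtain ⟨m₀⟩ := hne
    refine ⟨fun i => if h : i ∈ s then m ⟨i, h⟩ else m₀, fun i => ?_, (hψ _).2 ?_⟩
    · dsimp only
      split_ifs
      exacts [(m _).2, m₀.2]
    · convert hm using 1
      ext i
      simp
  have := Filter.iInf_neBot_of_directed' hdir hS
  have hU : ∀ φ, S φ ∈ Ultrafilter.of (⨅ φ, Filter.principal (S φ)) := fun φ =>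
    Ultrafilter.of_le _ (Filter.mem_iInf_of_mem φ (Filter.mem_principal_self _))
  refine ⟨Ultrafilter.of (⨅ φ, Filter.principal (S φ)), ?_, fun φ hφ => ?_⟩
  · filter_upwards [hU ⟨⊤, Formula.realize_top.2 trivial⟩] with x hx using hx.1
  · filter_upwards [hU ⟨φ, hφ⟩] with x hx using hx.2

/-- A normal subgroup containing the pointwise stabilizer of a short tuple contains the pointwise
stabilizer of every small elementary substructure. -/
theorem mem_of_fixes_elementarySubstructure [Nonempty C] {κ : Cardinal.{w}}
    (hsat : IsSaturated L C κ) (hhom : IsStronglyHomogeneous L C κ) (hκ : ℵ₀ ≤ κ)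
    (H : Subgroup (C ≃[L] C)) [hH : H.Normal] {α : Type w} (hα : #α < κ) (d : α → C)
    (hd : ∀ σ : C ≃[L] C, (∀ i, σ (d i) = d i) → σ ∈ H)
    (M : L.ElementarySubstructure C) {σ : C ≃[L] C} (hσ : ∀ x ∈ M, σ x = x) : σ ∈ H := by
  have hαα : #(α ⊕ α) < κ := by simpa using add_lt_of_lt hκ hα hα
  obtain ⟨U, hUM, hU⟩ := exists_ultrafilter_elementarySubstructure M d
  obtain ⟨e, he⟩ := exists_realize_ultrafilter_over hsat hhom hκ hα hαα U
    (Sum.elim d (fun i => σ (d i)))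
  obtain ⟨τ, hτ⟩ := hhom.exists_equiv hα (f := d) (g := e) (by
    intro φ hφ
    have := he (φ.relabel Sum.inl)
    simp only [Formula.realize_relabel, Sum.elim_comp_inl] at this
    exact this (hU φ hφ))
  obtain ⟨ρ, hρ⟩ := hhom.exists_equiv hαα (f := Sum.elim e d)
    (g := Sum.elim e (fun i => σ (d i))) (by
      intro φ hφ
      -- For `x` in `M`, `φ(x, d)` implies `φ(x, σ(d))` since `σ` fixes `x`; the implication passes
      -- to `e`.
      have := he ((φ.relabel (Sum.map id Sum.inl)).imp (φ.relabel (Sum.map id Sum.inr)))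
      simp only [Formula.realize_imp, Formula.realize_relabel, Sum.elim_comp_map, Function.comp_id,
        Sum.elim_comp_inl, Sum.elim_comp_inr] at this
      refine this ?_ hφ
      filter_upwards [hUM] with x hx hφx
      rw [← StrongHomClass.realize_formula σ φ] at hφx
      convert hφx using 1
      ext (i | i)
      · exact (hσ _ (hx i)).symm
      · rfl)
  have hρH : ρ ∈ H := by
    have h := hH.conj_mem _ (hd (τ⁻¹ * ρ * τ) fun i => ?_) τ
    · simpa [mul_assoc] using h
    · change τ.symm (ρ (τ (d i))) = d i
      rw [hτ, show ρ (e i) = e i from hρ (Sum.inl i), ← hτ, τ.symm_apply_apply]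
  have h := H.mul_mem hρH (hd (ρ⁻¹ * σ) fun i => ?_)
  · simpa using h
  · change ρ.symm (σ (d i)) = d i
    rw [← show ρ (d i) = σ (d i) from hρ (Sum.inr i), ρ.symm_apply_apply]

/-- A subgroup of bounded index containing the pointwise stabilizer of a short tuple contains the
pointwise stabilizer of every small elementary substructure. -/
theorem mem_of_fixes_elementarySubstructure_of_index_lt [Nonempty C] {κ : Cardinal.{w}}
    (hsat : IsSaturated L C κ) (hhom : IsStronglyHomogeneous L C κ) (hκ : ℵ₀ ≤ κ)
    (G : Subgroup (C ≃[L] C)) (hindex : #((C ≃[L] C) ⧸ G) < κ) {α : Type w} (hα : #α < κ)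
    (a : α → C) (ha : ∀ σ : C ≃[L] C, (∀ i, σ (a i) = a i) → σ ∈ G)
    (M : L.ElementarySubstructure C) {σ : C ≃[L] C} (hσ : ∀ x ∈ M, σ x = x) : σ ∈ G := by
  refine G.normalCore_le (mem_of_fixes_elementarySubstructure hsat hhom hκ G.normalCore
    (α := ((C ≃[L] C) ⧸ G) × α) (by simpa using mul_lt_of_lt hκ hindex hα)
    (fun q => q.1.out (a q.2)) (fun τ hτ g => ?_) M hσ)
  -- Conjugating `τ` by `g` reduces, modulo the element `g * q.out` of `G`, to conjugating by
  -- `q.out⁻¹`, which gives an automorphism fixing `a`.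
  let q : (C ≃[L] C) ⧸ G := (g⁻¹ : C ≃[L] C)
  have hq : g * q.out ∈ G := by
    have : (q.out : (C ≃[L] C) ⧸ G) = (g⁻¹ : C ≃[L] C) := QuotientGroup.out_eq' q
    simpa using QuotientGroup.eq.1 this.symm
  have hmem : q.out⁻¹ * τ * q.out ∈ G := ha _ fun i => by
    change q.out.symm (τ (q.out (a i))) = a i
    rw [hτ (q, i), q.out.symm_apply_apply]
  have h := G.mul_mem (G.mul_mem hq hmem) (G.inv_mem hq)
  simpa [mul_assoc] using h

/-! ### Closedness in the type topology -/

/-- The formulas over `N` true of `σ(n̄)` hold of `τ(n̄)` for all `τ` with `tp(τ(n̄)/N)` close to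
`tp(σ(n̄)/N)`. -/
theorem eventually_realize_of_tendsto_typeMap [Nonempty C] (N : L.ElementarySubstructure C)
    {l : Filter (C ≃[L] C)} {σ : C ≃[L] C}
    (hl : Filter.Tendsto (typeMap N) l (nhds (typeMap N σ)))
    (φ : L.Formula (N ⊕ N)) (hφ : φ.Realize (Sum.elim (fun x => (x : C)) (fun x => σ x))) :
    ∀ᶠ τ in l, φ.Realize (Sum.elim (fun x : N => (x : C)) (fun x => τ x)) := by
  let χ : L[[(N : Set C)]].Formula N := BoundedFormula.constantsVarsEquiv.symm φ
  have hχ : ∀ τ : C ≃[L] C, typeMap N τ ∈ Theory.typesWith _ (Formula.equivSentence χ) ↔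
      φ.Realize (Sum.elim (fun x : N => (x : C)) (fun x => τ x)) := fun τ =>
    (Theory.CompleteType.mem_typesWith_iff _ _).trans
      (Theory.CompleteType.formula_mem_typeOf.trans (realize_constantsVarsEquiv_symm φ _))
  filter_upwards [hl ((_root_.CompleteType.isOpen_typesWith _).mem_nhds ((hχ σ).2 hφ))] with τ hτ
  exact (hχ τ).1 hτ

/-- A relatively type-definable subgroup containing the pointwise stabilizer of `N` is closed in the
topology induced from the space of types over `N`. -/
theorem mem_of_typeMap_mem_closure [Nonempty C] {κ : Cardinal.{w}}
    (hsat : IsSaturated L C κ) (hhom : IsStronglyHomogeneous L C κ) (hκ : ℵ₀ ≤ κ)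
    (G : Subgroup (C ≃[L] C)) (hdef : IsRelativelyTypeDefinable κ (G : Set (C ≃[L] C)))
    (N : L.ElementarySubstructure C) (hN : #N < κ)
    (hGN : ∀ σ : C ≃[L] C, (∀ x ∈ N, σ x = x) → σ ∈ G) {σ : C ≃[L] C}
    (hσ : typeMap N σ ∈ closure (typeMap N '' (G : Set (C ≃[L] C)))) : σ ∈ G := by
  obtain ⟨ι, ι', π, a, b, hι, hι', hG⟩ := hdef
  have hNι : #(N ⊕ ι) < κ := by simpa using add_lt_of_lt hκ hN hι
  have hNι' : #(N ⊕ ι') < κ := by simpa using add_lt_of_lt hκ hN hι'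
  have hNN : #(N ⊕ N) < κ := by simpa using add_lt_of_lt hκ hN hN
  have hneBot : (Filter.principal (G : Set (C ≃[L] C)) ⊓
      Filter.comap (typeMap N) (nhds (typeMap N σ))).NeBot := by
    rw [← Filter.map_neBot_iff (typeMap N), Filter.push_pull, Filter.map_principal, inf_comm]
    exact mem_closure_iff_clusterPt.1 hσ
  let W := Ultrafilter.of (Filter.principal (G : Set (C ≃[L] C)) ⊓
      Filter.comap (typeMap N) (nhds (typeMap N σ)))
  have hWG : ∀ᶠ τ in W, τ ∈ G :=
    (Ultrafilter.of_le _).trans inf_le_left (Filter.mem_principal_self _)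
  have hWσ : Filter.Tendsto (typeMap N) W (nhds (typeMap N σ)) :=
    Filter.tendsto_iff_comap.2 ((Ultrafilter.of_le _).trans inf_le_right)
  -- One joint limit of `(τ(n̄), τ(a))` over `N` and `b`: the first part retains the type of `σ(n̄)`
  -- over `N`, the second retains `π`.
  obtain ⟨f, hf⟩ := exists_realize_ultrafilter_over hsat hhom hκ hNι hNι'
    (W.map fun τ => Sum.elim (fun x : N => τ x) (fun i => τ (a i)))
    (Sum.elim (fun x : N => (x : C)) b)
  simp only [Ultrafilter.coe_map, Filter.eventually_map] at hf
  obtain ⟨τ, hτ⟩ := hhom.exists_equiv hNι (f := Sum.elim (fun x : N => (x : C)) a) (g := f) (by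
    intro φ hφ
    have := hf (φ.relabel Sum.inl)
    simp only [Formula.realize_relabel, Sum.elim_comp_inl] at this
    refine this (Filter.Eventually.of_forall fun τ => ?_)
    rw [← StrongHomClass.realize_formula τ φ] at hφ
    convert hφ using 1
    ext (_ | _) <;> rfl)
  have hτG : τ ∈ G := by
    rw [← SetLike.mem_coe, hG]
    intro φ hφ
    have := hf (φ.relabel (Sum.map Sum.inr Sum.inr))
    simp only [Formula.realize_relabel, Sum.elim_comp_map, Sum.elim_comp_inr] at this
    convert this ?_ using 2
    · exact funext fun i => hτ (Sum.inr i)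
    · filter_upwards [hWG] with ρ hρ
      rw [← SetLike.mem_coe, hG] at hρ
      exact hρ φ hφ
  obtain ⟨ρ, hρ⟩ := hhom.exists_equiv hNN (f := Sum.elim (fun x : N => (x : C)) (fun x => σ x))
    (g := Sum.elim (fun x : N => (x : C)) (fun x => τ x)) (by
      intro φ hφ
      have := hf (φ.relabel (Sum.elim (Sum.inr ∘ Sum.inl) (Sum.inl ∘ Sum.inl)))
      simp only [Formula.realize_relabel, Sum.comp_elim, ← Function.comp_assoc,
        Sum.elim_comp_inl, Sum.elim_comp_inr] at this
      convert this (eventually_realize_of_tendsto_typeMap N hWσ φ hφ) using 2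
      exact funext fun x => hτ (Sum.inl x))
  have hρG : ρ ∈ G := hGN ρ fun x hx => hρ (Sum.inl ⟨x, hx⟩)
  have hmem : τ⁻¹ * ρ * σ ∈ G := hGN _ fun x hx => by
    change τ.symm (ρ (σ x)) = x
    rw [show ρ (σ x) = τ x from hρ (Sum.inr ⟨x, hx⟩), τ.symm_apply_apply]
  have h := G.mul_mem (G.inv_mem hρG) (G.mul_mem hτG hmem)
  simpa [mul_assoc] using h

end MonsterModel

theorem mainTheorem11 {L : FirstOrder.Language.{u, v}} {T : L.Theory} {κ : Cardinal.{w}}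
    {C : Type w} [L.Structure C] [Nonempty C] (hC : MonsterModel.IsMonster C T κ)
    (G : Subgroup (C ≃[L] C))
    (hdef : MonsterModel.IsRelativelyTypeDefinable κ (G : Set (C ≃[L] C)))
    (hindex : #((C ≃[L] C) ⧸ G) < κ)
    (N : L.ElementarySubstructure C) (hN : #N < κ) :
    MonsterModel.autfKP κ N ⊆ (G : Set (C ≃[L] C)) := by
  open MonsterModel in
  have hfix : ∀ (M : L.ElementarySubstructure C) (σ : C ≃[L] C), (∀ x ∈ M, σ x = x) → σ ∈ G := by
    obtain ⟨ι, ι', π, a, b, hι, -, hG⟩ := hdef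
    refine fun M σ hσ => mem_of_fixes_elementarySubstructure_of_index_lt hC.saturated
      hC.homogeneous hC.aleph0_lt.le G hindex hι a (fun τ hτ => ?_) M hσ
    have h1 : (1 : C ≃[L] C) ∈ (G : Set (C ≃[L] C)) := G.one_mem
    rw [hG] at h1
    rw [← SetLike.mem_coe, hG]
    intro φ hφ
    simp only [hτ]
    exact h1 φ hφ
  have hL : autfL L C κ ≤ G := (Subgroup.closure_le _).2 fun σ ⟨M, _, hM⟩ => hfix M σ hM
  intro σ hσ
  let _ : TopologicalSpace (C ≃[L] C) := TopologicalSpace.induced (typeMap N) inferInstance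
  let _ : TopologicalSpace (GalL L C κ) := galLTopology κ N
  let F : Set (GalL L C κ) := (fun σ : C ≃[L] C => (σ : GalL L C κ)) '' G
  -- `G` is a union of cosets of `autfL`, so closedness of `F` can be checked on `G` in the induced
  -- topology.
  have hpre : (fun σ : C ≃[L] C => (σ : GalL L C κ)) ⁻¹' F = G := by
    refine Set.Subset.antisymm ?_ (Set.subset_preimage_image _ _)
    rintro τ ⟨ρ, hρ, h⟩
    simpa using G.mul_mem hρ (hL (QuotientGroup.eq.1 h))
  have hF : IsClosed F := by
    refine isClosed_coinduced.2 (hpre ▸ isClosed_of_closure_subset fun τ hτ => ?_)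
    rw [closure_induced] at hτ
    exact mem_of_typeMap_mem_closure hC.saturated hC.homogeneous hC.aleph0_lt.le G hdef N hN
      (hfix N) hτ
  have hmem : (σ : GalL L C κ) ∈ F :=
    closure_minimal (Set.singleton_subset_iff.2 (Set.mem_image_of_mem _ G.one_mem)) hF hσ
  exact hpre.subset hmem
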